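/- A parity game consists of a finite directed graph $(V,E)$ in which every vertex has at least one successor, a starting vertex $s\in V$, and a priority $\mathrm{val}(v)\in\{1,\dots,m\}$ for each vertex $v$. Two players, Anke and Boris, move alternately along edges, starting at $s$ with Anke moving first, producing an infinite play $v_0=s,v_1,v_2,\dots$. Anke wins the play iff $\limsup_t \mathrm{val}(v_t)$ is even, and she wins the parity game if she has a (history-dependent) strategy such that she wins every play in which she follows it. Let $k$ be a natural number with $2^k>2|V|$. A statistic is an increasing partial function $f:\{0,\dots,k\}\to\{1,\dots,m\}$ (that is, $f(i)\le f(j)$ for all $i\le j$ in $\mathrm{dom}(f)$). Inserting $c$ at index $\ell$ removes from $f$ all pairs of index $\le\ell$ and adds the pair $(\ell,c)$. The update of $f$ by a priority $c$ applies successively the following two rules. (I) If $c$ is even, insert $c$ at the highest index $j\in\{0,\dots,k\}$ such that $f$ is defined and even on $0,\dots,j-1$. (II) If the resulting partial function takes some value $<c$, insert $c$ at the highest index $j$ of its domain at which its value is $<c$. Along a play, the statistics are $f_0=\emptyset$ and $f_{t+1}=$ the update of $f_t$ by $\mathrm{val}(v_t)$. Anke wins the statistics game if she has a strategy such that in every play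 in which she follows it there is some $t$ with $k\in\mathrm{dom}(f_t)$. Corollary. If Anke wins the statistics game, then she wins the parity game. -/

import Mathlib

/-- A parity game on the vertex set `V`: a directed graph in which every vertex has a successor,
a starting vertex, and a priority in `{1, …, maxPriority}` for every vertex. -/
structure ParityGame (V : Type*) where
  Edge : V → V → Prop
  exists_edge : ∀ v, ∃ w, Edge v w
  start : V
  maxPriority : ℕ
  priority : V → ℕ
  priority_mem : ∀ v, priority v ∈ Finset.Icc 1 maxPriority

/-- A partial function from `{0, …, k}` to the priorities; `none` means undefined.
The ones that occur in a game are increasing with values in `{1, …, m}`: see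
`Statistic.IsIncreasing.update`. -/
abbrev Statistic (k : ℕ) := Fin (k + 1) → Option ℕ

namespace Statistic

variable {k : ℕ}

/-- The statistic with empty domain. -/
def empty (k : ℕ) : Statistic k := fun _ => none

/-- Inserting `c` at index `l` removes all pairs of index `≤ l` and adds the pair `(l, c)`. -/
def insertAt (f : Statistic k) (l : Fin (k + 1)) (c : ℕ) : Statistic k :=
  fun i => if i < l then none else if i = l then some c else f i

/-- Insert `c` at the highest index satisfying `P`; do nothing if there is no such index. -/
def insertHighest (f : Statistic k) (P : Fin (k + 1) → Prop) [DecidablePred P] (c : ℕ) :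
    Statistic k :=
  if h : (Finset.univ.filter P).Nonempty then f.insertAt ((Finset.univ.filter P).max' h) c else f

/-- If `c` is even, it is inserted at the highest index `j` in `{0, …, k}` such that `f` is defined
and even on `0, …, j - 1`. -/
def ruleI (f : Statistic k) (c : ℕ) : Statistic k :=
  if Even c then f.insertHighest (fun j => ∀ i < j, ∃ d ∈ f i, Even d) c else f

/-- If `f` takes a value `< c`, then `c` is inserted at the highest index `j` in the domain
of `f` such that `f j < c`. -/
def ruleII (f : Statistic k) (c : ℕ) : Statistic k :=
  f.insertHighest (fun j => ∃ d ∈ f j, d < c) c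

/-- The update of `f` by the priority `c`: the two rules in succession. -/
def update (f : Statistic k) (c : ℕ) : Statistic k := (f.ruleI c).ruleII c

/-- `f` is an increasing partial function from `{0, …, k}` to `{1, …, m}`. -/
structure IsIncreasing (m : ℕ) (f : Statistic k) : Prop where
  mem : ∀ i, ∀ a ∈ f i, a ∈ Finset.Icc 1 m
  mono : ∀ i j, i ≤ j → ∀ a ∈ f i, ∀ b ∈ f j, a ≤ b

theorem isIncreasing_empty (m k : ℕ) : IsIncreasing m (empty k) :=
  ⟨by simp [empty], by simp [empty]⟩

theorem IsIncreasing.insertAt {m : ℕ} {f : Statistic k} (hf : f.IsIncreasing m) {c : ℕ}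
    (hc : c ∈ Finset.Icc 1 m) (l : Fin (k + 1)) (hl : ∀ i, l < i → ∀ b ∈ f i, c ≤ b) :
    (f.insertAt l c).IsIncreasing m := by
  have key : ∀ i, ∀ a ∈ f.insertAt l c i, (i = l ∧ a = c) ∨ (l < i ∧ a ∈ f i) := by
    intro i a ha
    unfold Statistic.insertAt at ha
    split_ifs at ha with h1 h2
    · simp at ha
    · left; simp at ha; exact ⟨h2, ha.symm⟩
    · right; exact ⟨lt_of_le_of_ne (not_lt.1 h1) (Ne.symm h2), ha⟩
  constructor
  · intro i a ha
    rcases key i a ha with ⟨_, rfl⟩ | ⟨_, h⟩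
    · exact hc
    · exact hf.mem i a h
  · intro i j hij a ha b hb
    rcases key i a ha with ⟨rfl, rfl⟩ | ⟨h1, h⟩ <;> rcases key j b hb with ⟨rfl, rfl⟩ | ⟨h1', h'⟩
    · exact le_rfl
    · exact hl j h1' b h'
    · exact absurd h1 (not_lt.2 hij)
    · exact hf.mono i j hij a h b h'

/-- Updating an increasing statistic by a priority in `{1, …, m}` gives an increasing statistic. -/
theorem IsIncreasing.update {m : ℕ} {f : Statistic k} (hf : f.IsIncreasing m) {c : ℕ}
    (hc : c ∈ Finset.Icc 1 m) : (f.update c).IsIncreasing m := by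
  have g1 : ∃ (l : Option (Fin (k + 1))), f.ruleI c = l.elim f (fun l => f.insertAt l c) := by
    unfold Statistic.ruleI Statistic.insertHighest
    split_ifs with h1 h2
    · exact ⟨some _, rfl⟩
    · exact ⟨none, rfl⟩
    · exact ⟨none, rfl⟩
  obtain ⟨l, hg⟩ := g1
  unfold Statistic.update
  generalize f.ruleI c = g at hg
  unfold Statistic.ruleII Statistic.insertHighest
  split_ifs with h
  · set L := (Finset.univ.filter (fun j => ∃ d ∈ g j, d < c)).max' h with hL
    have hmax : ∀ i, L < i → ∀ b ∈ g i, c ≤ b := by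
      intro i hi b hb
      by_contra hlt
      exact absurd (Finset.le_max' _ i (by simpa using ⟨b, by simpa using hb, not_le.1 hlt⟩))
        (not_le.2 hi)
    obtain ⟨d, hd, hdc⟩ : ∃ d ∈ g L, d < c := by
      have := Finset.max'_mem _ h
      rw [← hL] at this
      simpa using this
    cases l with
    | none => simp only [Option.elim] at hg; subst hg; exact hf.insertAt hc _ hmax
    | some l =>
      simp only [Option.elim] at hg
      have hlL : l < L := by
        by_contra hle
        rw [hg] at hd
        unfold Statistic.insertAt at hd
        split_ifs at hd with h1 h2
        · simp at hd
        · simp at hd; omega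
        · exact h2 (le_antisymm (not_lt.1 hle) (not_lt.1 h1))
      have e : g.insertAt L c = f.insertAt L c := by
        funext i
        rw [hg]
        unfold Statistic.insertAt
        split_ifs <;> first | rfl | (exfalso; order)
      rw [e]
      refine hf.insertAt hc _ fun i hi b hb => hmax i hi b ?_
      rw [hg]
      unfold Statistic.insertAt
      rwa [if_neg (not_lt.2 (hlL.trans hi).le), if_neg (hlL.trans hi).ne']
  · have hno : ∀ i, ∀ b ∈ g i, c ≤ b := by
      intro i b hb
      by_contra hlt
      exact h ⟨i, by simpa using ⟨b, by simpa using hb, not_le.1 hlt⟩⟩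
    cases l with
    | none => simp only [Option.elim] at hg; subst hg; exact hf
    | some l =>
      simp only [Option.elim] at hg
      rw [hg]
      refine hf.insertAt hc _ fun i hi b hb => hno i b ?_
      rw [hg]
      unfold Statistic.insertAt
      rwa [if_neg (not_lt.2 hi.le), if_neg hi.ne']

end Statistic

namespace ParityGame

variable {V : Type*} (G : ParityGame V)

/-- An infinite play `v₀, v₁, …`: it begins at the start vertex and follows edges. -/
def IsPlay (p : ℕ → V) : Prop := p 0 = G.start ∧ ∀ t, G.Edge (p t) (p (t + 1))

/-- A (history-dependent) strategy: `next h v` is the move chosen at the current vertex `v`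
when `h` is the list of the vertices visited before. Only valid moves are chosen. -/
structure Strategy where
  next : List V → V → V
  valid : ∀ h v, G.Edge v (next h v)

variable {G} in
/-- The play `p` is one in which Anke follows `σ`. The players alternate and Anke moves first,
so the moves at even dates are hers. -/
def Strategy.AnkeFollows (σ : G.Strategy) (p : ℕ → V) : Prop :=
  ∀ t, Even t → p (t + 1) = σ.next ((List.range t).map p) (p t)

/-- Anke has a strategy that enforces the winning condition `W`. -/
def AnkeEnforces (W : (ℕ → V) → Prop) : Prop :=
  ∃ σ : G.Strategy, ∀ p, G.IsPlay p → σ.AnkeFollows p → W p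

/-- Anke wins the parity game: she can enforce that the limsup of the priorities is even. -/
def AnkeWinsParityGame : Prop :=
  G.AnkeEnforces fun p => Even (Filter.limsup (fun t => G.priority (p t)) Filter.atTop)

/-- The sequence of statistics along a play: start with the empty statistic and update
successively by the priorities of `p 0, p 1, …`. -/
def statistics (k : ℕ) (p : ℕ → V) : ℕ → Statistic k
  | 0 => Statistic.empty k
  | t + 1 => (statistics k p t).update (G.priority (p t))

/-- Anke wins the statistics game with parameter `k`: she can enforce a visit to a statistic
whose domain contains `k`. -/
def AnkeWinsStatisticsGame (k : ℕ) : Prop :=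
  G.AnkeEnforces fun p => ∃ t, (G.statistics k p t (Fin.last k)).isSome

end ParityGame

/-!
The statistics record even chains. If `f_t` has a value at index `i`, then there are `2 ^ i` dates
before `t` such that the maximal priority between any two of them is even (`Statistic.Records`).
Rule (I) merges the chains with indices `0, …, j - 1` and the current date, which gives
`1 + 2 + ⋯ + 2 ^ (j - 1) + 1 = 2 ^ j` dates; rule (II) keeps the maximal priority since the end of
a chain up to date. Once `k` is in the domain, there are `2 ^ k > 2 |V|` dates in one chain, so at
two of them the play visits the same vertex with the same player to move: the play contains a cycle
with even maximal priority (`ParityGame.exists_even_cycle`).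

Let Anke play a winning strategy of the statistics game against a positional strategy of Boris, in
the arena of pairs of a vertex and a player. The resulting cycle is one in which Boris has no
choice, so Anke can repeat it forever: she beats every positional strategy of Boris in the parity
game (`ParityGame.nonempty_strategyGraph_of_positional`).

It remains to see that positional strategies suffice for Boris
(`StrategyGraph.nonempty_of_forall_positional`). His positions are freed one at a time. Suppose that
Anke wins whenever Boris is restricted to one move `w` at the position `v`. If one of her winning
strategies never lets the play reach `v`, it also wins without the restriction. Otherwise she keeps
a separate memory for each `w`, every one of them at `v` while it is not in use, and after
Boris has moved from `v` to `w` she continues with the strategy for `w` where it was interrupted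
(`StrategyGraph.shuffle`). The play is then a shuffle of finitely many plays, and its limes superior
is the maximum of those of the infinite ones among them, which are even.
-/

/-! ### Chains of dates recorded by the statistics -/

namespace Statistic

/-- The combinatorial meaning of a statistic `f` for the priorities `c 0, c 1, …`: if `f i = b`,
then there are `2 ^ i` dates, forming the set `C i`, such that the maximal priority between any two
of them is even. The date `e i` is the one at which `b` was written. The maximal
priority from a date of `C i` up to `e i` is `b`, unless it is an even number `u ≥ b` (from the last
date of `C i` on, it is `b`, and up to that date it is even); later priorities are at most `b`; and
the dates of the sets with a lower index come after `e i`. The dates `e i` are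
bounded by `T`, and the bound `b` on later priorities is asserted for the dates before `t`: the
case `T = t + 1` describes the situation between the two update rules. -/
structure Records {k : ℕ} (c : ℕ → ℕ) (t T : ℕ) (f : Statistic k)
    (C : Fin (k + 1) → Finset ℕ) (e : Fin (k + 1) → ℕ) : Prop where
  card : ∀ i, ∀ b ∈ f i, (C i).card = 2 ^ (i : ℕ)
  even : ∀ i, ∀ b ∈ f i, ∀ x ∈ C i, ∀ y ∈ C i, x < y → Even ((Finset.Icc x y).sup c)
  le : ∀ i, ∀ b ∈ f i, ∀ x ∈ C i, x ≤ e i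
  sup : ∀ i, ∀ b ∈ f i, ∀ x ∈ C i, ∃ u, Even u ∧ (Finset.Icc x (e i)).sup c = max u b
  lt : ∀ i, ∀ b ∈ f i, e i < T
  bound : ∀ i, ∀ b ∈ f i, ∀ s, e i < s → s < t → c s ≤ b
  order : ∀ i, ∀ b ∈ f i, ∀ j < i, ∀ b' ∈ f j, ∀ x ∈ C j, e i < x

theorem mem_insertAt {k : ℕ} {f : Statistic k} {l : Fin (k + 1)} {c : ℕ} {i : Fin (k + 1)}
    {a : ℕ} : a ∈ f.insertAt l c i ↔ (i = l ∧ a = c) ∨ (l < i ∧ a ∈ f i) := by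
  unfold insertAt
  split_ifs with h1 h2
  · simp [h1.ne, h1.le]
  · subst h2; simp [eq_comm]
  · simp [h2, lt_of_le_of_ne (not_lt.1 h1) (Ne.symm h2)]

theorem sup_Icc_eq_of_le {c : ℕ → ℕ} {x e y b u : ℕ} (hxe : x ≤ e) (hey : e ≤ y)
    (hu : (Finset.Icc x e).sup c = max u b) (hb : ∀ s, e < s → s < y → c s ≤ b) :
    (Finset.Icc x y).sup c = max (max u b) (c y) := by
  apply le_antisymm
  · refine Finset.sup_le fun s hs => ?_
    rw [Finset.mem_Icc] at hs
    rcases le_or_gt s e with h | h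
    · have : c s ≤ (Finset.Icc x e).sup c := Finset.le_sup (Finset.mem_Icc.2 ⟨hs.1, h⟩)
      rw [hu] at this
      exact this.trans (le_max_left _ _)
    · rcases hs.2.eq_or_lt with rfl | h'
      · exact le_max_right _ _
      · exact (hb s h h').trans ((le_max_right _ _).trans (le_max_left _ _))
  · refine max_le ?_ (Finset.le_sup (Finset.mem_Icc.2 ⟨hxe.trans hey, le_rfl⟩))
    rw [← hu]
    exact Finset.sup_mono (Finset.Icc_subset_Icc_right hey)

theorem even_max {a b : ℕ} (ha : Even a) (hb : Even b) : Even (max a b) := by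
  rcases max_choice a b with h | h <;> rwa [h]

theorem sum_two_pow_filter_lt {k : ℕ} (j : Fin (k + 1)) :
    ∑ i ∈ Finset.univ.filter (· < j), 2 ^ (i : ℕ) + 1 = 2 ^ (j : ℕ) := by
  have : ∑ i ∈ Finset.univ.filter (· < j), 2 ^ (i : ℕ) = ∑ i ∈ Finset.range j, 2 ^ i := by
    refine Finset.sum_bij (fun i _ => (i : ℕ)) ?_ ?_ ?_ ?_
    · intro i hi; simpa using hi
    · intro a _ b _ h; exact Fin.ext h
    · intro b hb
      rw [Finset.mem_range] at hb
      exact ⟨⟨b, hb.trans j.2⟩, Finset.mem_filter.2 ⟨Finset.mem_univ _, hb⟩, rfl⟩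
    · intros; rfl
  rw [this, Nat.geomSum_eq le_rfl]
  have := Nat.one_le_two_pow (n := j)
  simp; omega

/-- Inserting an even priority `c t` at an index below which all values are defined and even:
the sets of dates with a lower index are merged, together with the date `t`. -/
theorem Records.insertAt_even {k : ℕ} {c : ℕ → ℕ} {t : ℕ} {f : Statistic k}
    {C : Fin (k + 1) → Finset ℕ} {e : Fin (k + 1) → ℕ} (h : Records c t t f C e)
    (hc : Even (c t)) {j : Fin (k + 1)} (hj : ∀ i < j, ∃ d ∈ f i, Even d) :
    Records c t (t + 1) (f.insertAt j (c t))
      (Function.update C j (insert t ((Finset.univ.filter (· < j)).biUnion C)))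
      (Function.update e j t) := by
  have hmem : ∀ x, x ∈ insert t ((Finset.univ.filter (· < j)).biUnion C) ↔
      x = t ∨ ∃ i < j, x ∈ C i := by simp
  have hlt : ∀ i < j, ∀ x ∈ C i, x < t := by
    intro i hi x hx
    obtain ⟨d, hd, -⟩ := hj i hi
    exact (h.le i d hd x hx).trans_lt (h.lt i d hd)
  -- From a date of a merged set, the maximal priority up to any later date `y` is even, as soon as
  -- `c y` is even or does not exceed the value recorded for that set.
  have hsup : ∀ i < j, ∀ x ∈ C i, ∀ d ∈ f i, Even d → ∀ y, e i < y → y ≤ t →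
      (Even (c y) ∨ c y ≤ d) → Even ((Finset.Icc x y).sup c) := by
    intro i hi x hx d hd hde y hy hyt hcy
    obtain ⟨u, hu, hs⟩ := h.sup i d hd x hx
    rw [sup_Icc_eq_of_le (h.le i d hd x hx) hy.le hs
      fun s h1 h2 => h.bound i d hd s h1 (h2.trans_le hyt)]
    rcases hcy with hcy | hcy
    · exact even_max (even_max hu hde) hcy
    · rw [max_eq_left (hcy.trans (le_max_right _ _))]
      exact even_max hu hde
  have hsupt : ∀ i < j, ∀ x ∈ C i, Even ((Finset.Icc x t).sup c) := by
    intro i hi x hx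
    obtain ⟨d, hd, hde⟩ := hj i hi
    exact hsup i hi x hx d hd hde t (h.lt i d hd) le_rfl (Or.inl hc)
  have hdisj : ∀ i < j, ∀ i' < i, ∀ x ∈ C i, ∀ y ∈ C i', x ≤ e i ∧ e i < y := by
    intro i hi i' hi' x hx y hy
    obtain ⟨d, hd, -⟩ := hj i hi
    obtain ⟨d', hd', -⟩ := hj i' (hi'.trans hi)
    exact ⟨h.le i d hd x hx, h.order i d hd i' hi' d' hd' y hy⟩
  constructor
  · intro i b hb
    rcases mem_insertAt.1 hb with ⟨rfl, -⟩ | ⟨hi, hib⟩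
    · rw [Function.update_self, Finset.card_insert_of_notMem, Finset.card_biUnion,
        ← sum_two_pow_filter_lt]
      · congr 1
        refine Finset.sum_congr rfl fun l hl => ?_
        obtain ⟨d, hd, -⟩ := hj l (by simpa using hl)
        exact h.card l d hd
      · intro a ha b hb hab
        rw [Finset.mem_coe, Finset.mem_filter] at ha hb
        refine Finset.disjoint_left.2 fun x hxa hxb => ?_
        rcases hab.lt_or_gt with hlt | hlt
        · have := hdisj b hb.2 a hlt x hxb x hxa; omega
        · have := hdisj a ha.2 b hlt x hxa x hxb; omega
      · intro ht
        simp only [Finset.mem_biUnion, Finset.mem_filter, Finset.mem_univ, true_and] at ht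
        obtain ⟨a, ha, hta⟩ := ht
        exact absurd (hlt a ha t hta) (lt_irrefl _)
    · rw [Function.update_of_ne hi.ne']; exact h.card i b hib
  · intro i b hb
    rcases mem_insertAt.1 hb with ⟨rfl, -⟩ | ⟨hi, hib⟩
    · rw [Function.update_self]
      intro x hx y hy hxy
      rcases (hmem x).1 hx with rfl | ⟨l, hl, hxl⟩
      · rcases (hmem y).1 hy with rfl | ⟨l', hl', hyl⟩
        · exact absurd hxy (lt_irrefl _)
        · exact absurd (hlt l' hl' y hyl) hxy.not_gt
      · rcases (hmem y).1 hy with rfl | ⟨l', hl', hyl⟩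
        · exact hsupt l hl x hxl
        · obtain ⟨d, hd, hde⟩ := hj l hl
          rcases lt_trichotomy l l' with hll | rfl | hll
          · have := hdisj l' hl' l hll y hyl x hxl; omega
          · exact h.even l d hd x hxl y hyl hxy
          · have h1 := (hdisj l hl l' hll x hxl y hyl).2
            have h2 := hlt l' hl' y hyl
            exact hsup l hl x hxl d hd hde y h1 h2.le (Or.inr (h.bound l d hd y h1 h2))
    · rw [Function.update_of_ne hi.ne']; exact h.even i b hib
  · intro i b hb
    rcases mem_insertAt.1 hb with ⟨rfl, -⟩ | ⟨hi, hib⟩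
    · rw [Function.update_self, Function.update_self]
      intro x hx
      rcases (hmem x).1 hx with rfl | ⟨l, hl, hxl⟩
      · exact le_rfl
      · exact (hlt l hl x hxl).le
    · rw [Function.update_of_ne hi.ne', Function.update_of_ne hi.ne']; exact h.le i b hib
  · intro i b hb
    rcases mem_insertAt.1 hb with ⟨rfl, rfl⟩ | ⟨hi, hib⟩
    · rw [Function.update_self, Function.update_self]
      intro x hx
      have hxt : x ≤ t := by
        rcases (hmem x).1 hx with rfl | ⟨l, hl, hxl⟩
        · exact le_rfl
        · exact (hlt l hl x hxl).le
      refine ⟨(Finset.Icc x t).sup c, ?_, ?_⟩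
      · rcases (hmem x).1 hx with rfl | ⟨l, hl, hxl⟩
        · simpa using hc
        · exact hsupt l hl x hxl
      · exact (max_eq_left (Finset.le_sup (Finset.mem_Icc.2 ⟨hxt, le_rfl⟩))).symm
    · rw [Function.update_of_ne hi.ne', Function.update_of_ne hi.ne']; exact h.sup i b hib
  · intro i b hb
    rcases mem_insertAt.1 hb with ⟨rfl, -⟩ | ⟨hi, hib⟩
    · rw [Function.update_self]; exact Nat.lt_succ_self t
    · rw [Function.update_of_ne hi.ne']; exact (h.lt i b hib).trans (Nat.lt_succ_self t)
  · intro i b hb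
    rcases mem_insertAt.1 hb with ⟨rfl, -⟩ | ⟨hi, hib⟩
    · rw [Function.update_self]
      intro s h1 h2
      omega
    · rw [Function.update_of_ne hi.ne']; exact h.bound i b hib
  · intro i b hb l hl b' hb'
    rcases mem_insertAt.1 hb with ⟨rfl, -⟩ | ⟨hi, hib⟩
    · rcases mem_insertAt.1 hb' with ⟨rfl, -⟩ | ⟨hi', -⟩
      · exact absurd hl (lt_irrefl _)
      · exact absurd hl hi'.not_gt
    · rw [Function.update_of_ne hi.ne']
      rcases mem_insertAt.1 hb' with ⟨rfl, -⟩ | ⟨hi', hlb⟩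
      · rw [Function.update_self]
        intro x hx
        rcases (hmem x).1 hx with rfl | ⟨l', hl', hxl⟩
        · exact h.lt i b hib
        · obtain ⟨d, hd, -⟩ := hj l' hl'
          exact h.order i b hib l' (hl'.trans hi) d hd x hxl
      · rw [Function.update_of_ne hi'.ne']
        exact h.order i b hib l hl b' hlb

/-- Inserting `c t` at the highest index with a value `d < c t`: the set of dates with that index
is kept. Since the priorities after `e j` were at most `d`, the new maximum `c t` replaces `d`. -/
theorem Records.insertAt_of_lt {k : ℕ} {c : ℕ → ℕ} {t : ℕ} {f : Statistic k}
    {C : Fin (k + 1) → Finset ℕ} {e : Fin (k + 1) → ℕ} (h : Records c t (t + 1) f C e)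
    {j : Fin (k + 1)} {d : ℕ} (hd : d ∈ f j) (hdc : d < c t)
    (hj : ∀ i, j < i → ∀ b ∈ f i, c t ≤ b) :
    Records c (t + 1) (t + 1) (f.insertAt j (c t)) C (Function.update e j t) := by
  constructor
  · intro i b hb
    rcases mem_insertAt.1 hb with ⟨rfl, -⟩ | ⟨hi, hib⟩
    · exact h.card i d hd
    · exact h.card i b hib
  · intro i b hb
    rcases mem_insertAt.1 hb with ⟨rfl, -⟩ | ⟨hi, hib⟩
    · exact h.even i d hd
    · exact h.even i b hib
  · intro i b hb
    rcases mem_insertAt.1 hb with ⟨rfl, -⟩ | ⟨hi, hib⟩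
    · rw [Function.update_self]
      intro x hx
      exact (h.le i d hd x hx).trans (Nat.lt_succ_iff.1 (h.lt i d hd))
    · rw [Function.update_of_ne hi.ne']; exact h.le i b hib
  · intro i b hb
    rcases mem_insertAt.1 hb with ⟨rfl, rfl⟩ | ⟨hi, hib⟩
    · rw [Function.update_self]
      intro x hx
      obtain ⟨u, hu, hs⟩ := h.sup i d hd x hx
      refine ⟨u, hu, ?_⟩
      rw [sup_Icc_eq_of_le (h.le i d hd x hx) (Nat.lt_succ_iff.1 (h.lt i d hd)) hs
        (h.bound i d hd), max_assoc, max_eq_right hdc.le]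
    · rw [Function.update_of_ne hi.ne']; exact h.sup i b hib
  · intro i b hb
    rcases mem_insertAt.1 hb with ⟨rfl, -⟩ | ⟨hi, hib⟩
    · rw [Function.update_self]; exact Nat.lt_succ_self t
    · rw [Function.update_of_ne hi.ne']; exact h.lt i b hib
  · intro i b hb s h1 h2
    rcases mem_insertAt.1 hb with ⟨rfl, -⟩ | ⟨hi, hib⟩
    · rw [Function.update_self] at h1
      omega
    · rw [Function.update_of_ne hi.ne'] at h1
      rcases (Nat.lt_succ_iff.1 h2).eq_or_lt with rfl | h2
      · exact hj i hi b hib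
      · exact h.bound i b hib s h1 h2
  · intro i b hb l hl b' hb'
    rcases mem_insertAt.1 hb with ⟨rfl, -⟩ | ⟨hi, hib⟩
    · rcases mem_insertAt.1 hb' with ⟨rfl, -⟩ | ⟨hi', -⟩
      · exact absurd hl (lt_irrefl _)
      · exact absurd hl hi'.not_gt
    · rw [Function.update_of_ne hi.ne']
      rcases mem_insertAt.1 hb' with ⟨rfl, -⟩ | ⟨hi', hlb⟩
      · exact h.order i b hib l hl d hd
      · exact h.order i b hib l hl b' hlb

theorem Records.ruleI {k : ℕ} {c : ℕ → ℕ} {t : ℕ} {f : Statistic k}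
    {C : Fin (k + 1) → Finset ℕ} {e : Fin (k + 1) → ℕ} (h : Records c t t f C e) :
    ∃ C' e', Records c t (t + 1) (f.ruleI (c t)) C' e' := by
  unfold Statistic.ruleI insertHighest
  split_ifs with hc hne
  · refine ⟨_, _, h.insertAt_even hc ?_⟩
    have := Finset.max'_mem _ hne
    rw [Finset.mem_filter] at this
    exact this.2
  all_goals
    exact ⟨C, e, h.card, h.even, h.le, h.sup,
      fun i b hb => (h.lt i b hb).trans (Nat.lt_succ_self t), h.bound, h.order⟩

theorem Records.ruleII {k : ℕ} {c : ℕ → ℕ} {t : ℕ} {f : Statistic k}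
    {C : Fin (k + 1) → Finset ℕ} {e : Fin (k + 1) → ℕ} (h : Records c t (t + 1) f C e) :
    ∃ C' e', Records c (t + 1) (t + 1) (f.ruleII (c t)) C' e' := by
  unfold Statistic.ruleII insertHighest
  split_ifs with hne
  · have hmem := Finset.max'_mem _ hne
    rw [Finset.mem_filter] at hmem
    obtain ⟨-, d, hd, hdc⟩ := hmem
    refine ⟨_, _, h.insertAt_of_lt hd hdc fun i hi b hb => ?_⟩
    by_contra hlt
    exact absurd (Finset.le_max' _ i (Finset.mem_filter.2 ⟨Finset.mem_univ _, b, hb, not_le.1 hlt⟩))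
      (not_le.2 hi)
  · refine ⟨C, e, h.card, h.even, h.le, h.sup, h.lt, fun i b hb s h1 h2 => ?_, h.order⟩
    rcases (Nat.lt_succ_iff.1 h2).eq_or_lt with rfl | h2
    · by_contra hlt
      exact hne ⟨i, Finset.mem_filter.2 ⟨Finset.mem_univ _, b, hb, not_le.1 hlt⟩⟩
    · exact h.bound i b hb s h1 h2

end Statistic

namespace ParityGame

theorem exists_records_statistics {V : Type*} (G : ParityGame V) (k : ℕ) (p : ℕ → V) (t : ℕ) :
    ∃ C e, Statistic.Records (fun s => G.priority (p s)) t t (G.statistics k p t) C e := by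
  induction t with
  | zero => exact ⟨fun _ => ∅, fun _ => 0, by constructor <;> simp [statistics, Statistic.empty]⟩
  | succ t ih =>
    obtain ⟨C, e, h⟩ := ih
    obtain ⟨C', e', h'⟩ := h.ruleI
    exact h'.ruleII

/-- A statistic whose domain contains `k` reveals a cycle of the play whose maximal priority is
even, even among the positions that record whose turn it is. -/
theorem exists_even_cycle {V : Type*} [Fintype V] (G : ParityGame V) {k : ℕ}
    (hk : 2 * Fintype.card V < 2 ^ k) {p : ℕ → V} {t : ℕ}
    (h : (G.statistics k p t (Fin.last k)).isSome) :
    ∃ x y, x < y ∧ p x = p y ∧ (Even x ↔ Even y) ∧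
      Even ((Finset.Icc x y).sup fun s => G.priority (p s)) := by
  classical
  obtain ⟨C, e, hr⟩ := G.exists_records_statistics k p t
  obtain ⟨b, hb⟩ := Option.isSome_iff_exists.1 h
  obtain ⟨x, hx, y, hy, hne, heq⟩ := Finset.exists_ne_map_eq_of_card_lt_of_maps_to
    (s := C (Fin.last k)) (t := (Finset.univ : Finset (V × Bool)))
    (by rw [hr.card _ b hb]; simpa [mul_comm] using hk)
    (f := fun x => (p x, decide (Even x))) (fun _ _ => Finset.mem_coe.2 (Finset.mem_univ _))
  simp only [Prod.mk.injEq, decide_eq_decide] at heq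
  rcases hne.lt_or_gt with hlt | hlt
  · exact ⟨x, y, hlt, heq.1, heq.2, hr.even _ b hb x hx y hy hlt⟩
  · exact ⟨y, x, hlt, heq.1.symm, heq.2.symm, hr.even _ b hb y hy x hx hlt⟩

end ParityGame

/-! ### Sequences whose largest recurring value is even -/

/-- The largest value that `c` takes infinitely often exists and is even. -/
def MaxRecurringEven (c : ℕ → ℕ) : Prop :=
  ∃ m, Even m ∧ (∃ᶠ t in Filter.atTop, c t = m) ∧ ∀ᶠ t in Filter.atTop, c t ≤ m

theorem MaxRecurringEven.even_limsup {c : ℕ → ℕ} (h : MaxRecurringEven c) :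
    Even (Filter.limsup c Filter.atTop) := by
  obtain ⟨m, hm, hf, he⟩ := h
  have hb : Filter.IsBoundedUnder (· ≤ ·) Filter.atTop c := ⟨m, by simpa using he⟩
  have : Filter.limsup c Filter.atTop = m := by
    apply le_antisymm
    · exact Filter.limsup_le_of_le (by isBoundedDefault) he
    · exact Filter.le_limsup_of_frequently_le (hf.mono fun t ht => ht.ge) hb
  rwa [this]

/-- A sequence that is cut into finitely many subsequences has an even largest recurring value if
each of the infinite subsequences has. -/
theorem MaxRecurringEven.of_shuffle {I : Type*} [Finite I] {c : ℕ → ℕ} (label : ℕ → I)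
    (h : ∀ w, {t | label t = w}.Infinite →
      MaxRecurringEven fun n => c (Nat.nth (fun t => label t = w) n)) :
    MaxRecurringEven c := by
  have h' : ∀ w : {w // {t | label t = w}.Infinite}, ∃ m, Even m ∧
      (∃ᶠ t in Filter.atTop, c t = m) ∧
      ∀ᶠ t in Filter.atTop, label t = (w : I) → c t ≤ m := by
    rintro ⟨w, hw⟩
    obtain ⟨m, hm, hf, he⟩ := h w hw
    refine ⟨m, hm, (Nat.nth_strictMono hw).tendsto_atTop.frequently hf, ?_⟩
    obtain ⟨N, hN⟩ := Filter.eventually_atTop.1 he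
    refine Filter.eventually_atTop.2 ⟨Nat.nth (fun t => label t = w) N, fun t ht htw => ?_⟩
    obtain ⟨n, rfl⟩ : ∃ n, Nat.nth (fun t => label t = w) n = t := by
      classical exact ⟨_, Nat.nth_count htw⟩
    exact hN n ((Nat.nth_le_nth hw).1 ht)
  choose m hm hf he using h'
  have hne : Nonempty {w // {t | label t = w}.Infinite} := by
    obtain ⟨w, hw⟩ := Finite.exists_infinite_fiber label
    exact ⟨w, Set.infinite_coe_iff.1 hw⟩
  obtain ⟨w, hw⟩ := Finite.exists_max m
  refine ⟨m w, hm w, hf w, ?_⟩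
  have hall : ∀ w', ∀ᶠ t in Filter.atTop, label t = w' → c t ≤ m w := by
    intro w'
    by_cases hi : {t | label t = w'}.Infinite
    · exact (he ⟨w', hi⟩).mono fun t ht htw => (ht htw).trans (hw _)
    · have : ∀ᶠ t in Filter.atTop, ¬ label t = w' := by
        rw [← Filter.not_frequently, Nat.frequently_atTop_iff_infinite]; exact hi
      exact this.mono fun t ht htw => absurd htw ht
  exact (Filter.eventually_all.2 hall).mono fun t ht => ht _ rfl

/-! ### Strategies as graphs, and positional determinacy for the opponent -/

universe u

/-- A winning strategy of a player (whose positions are those satisfying `own`) from the position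
`s` in the parity game with edges `E` and priorities `pr`, presented as a graph that covers the
arena: its states lie over positions, every state over a position of the player has a successor,
every state over a position of the opponent has a successor over each possible move, and along
every infinite path the largest recurring priority is even. -/
structure StrategyGraph {P : Type u} (own : P → Prop) (E : P → P → Prop) (pr : P → ℕ) (s : P) where
  State : Type u
  root : State
  pos : State → P
  Step : State → State → Prop
  pos_root : pos root = s
  edge : ∀ {a b}, Step a b → E (pos a) (pos b)
  own_move : ∀ a, own (pos a) → ∃ b, Step a b
  opp_move : ∀ a, ¬ own (pos a) → ∀ y, E (pos a) y → ∃ b, Step a b ∧ pos b = y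
  win : ∀ q : ℕ → State, (∀ t, Step (q t) (q (t + 1))) → MaxRecurringEven fun t => pr (pos (q t))

namespace StrategyGraph

variable {P : Type u} {own : P → Prop} {E : P → P → Prop} {pr : P → ℕ} {s v : P}

/-- If a strategy for the game in which the opponent has to move from `v` to `w` never meets `v`,
then it is a strategy for the whole game. -/
def ofAvoiding {w : P} (g : StrategyGraph own (fun x y => E x y ∧ (x = v → y = w)) pr s)
    (h : ∀ a, Relation.ReflTransGen g.Step g.root a → g.pos a ≠ v) :
    StrategyGraph own E pr s where
  State := {a // Relation.ReflTransGen g.Step g.root a}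
  root := ⟨g.root, .refl⟩
  pos a := g.pos a
  Step a b := g.Step a b
  pos_root := g.pos_root
  edge hab := (g.edge hab).1
  own_move := by
    rintro ⟨a, ha⟩ hown
    obtain ⟨b, hb⟩ := g.own_move a hown
    exact ⟨⟨b, ha.tail hb⟩, hb⟩
  opp_move := by
    rintro ⟨a, ha⟩ hown y hy
    obtain ⟨b, hb, rfl⟩ := g.opp_move a hown y ⟨hy, fun hv => absurd hv (h a ha)⟩
    exact ⟨⟨b, ha.tail hb⟩, hb, rfl⟩
  win q hq := g.win (fun t => q t) hq

/-- The shuffle of strategies `g w` for the games in which the opponent always has to move from his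
position `v` to `w`. One of the strategies is active; the others wait in a state over `v`. At each
visit to `v`, the opponent's choice `w` of a move makes `g w` the active strategy. -/
noncomputable def shuffle [Finite P] (hv : ¬ own v)
    (g : ∀ w : {w // E v w},
      StrategyGraph own (fun x y => E x y ∧ (x = v → y = w)) pr s)
    (w₀ : {w // E v w}) (wait : ∀ w, (g w).State) (hwait : ∀ w, (g w).pos (wait w) = v) :
    StrategyGraph own E pr s := by
  classical
  exact
  { State := {x : (Σ _ : {w // E v w}, ∀ w, (g w).State) //
      ∀ w, w ≠ x.1 → (g w).pos (x.2 w) = v}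
    root := ⟨⟨w₀, Function.update wait w₀ (g w₀).root⟩, fun w hw => by
      simpa only [Function.update_of_ne hw] using hwait w⟩
    pos := fun x => (g x.1.1).pos (x.1.2 x.1.1)
    -- The strategy that is active after the step is the one that moves.
    Step := fun x x' => (g x'.1.1).pos (x.1.2 x'.1.1) = (g x.1.1).pos (x.1.2 x.1.1) ∧
      (g x'.1.1).Step (x.1.2 x'.1.1) (x'.1.2 x'.1.1) ∧ ∀ w, w ≠ x'.1.1 → x'.1.2 w = x.1.2 w
    pos_root := by simpa only [Function.update_self] using (g w₀).pos_root
    edge := by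
      rintro x x' ⟨h1, h2, -⟩
      have := ((g x'.1.1).edge h2).1
      rwa [h1] at this
    own_move := by
      rintro ⟨⟨w, a⟩, hx⟩ hown
      obtain ⟨b, hb⟩ := (g w).own_move (a w) hown
      refine ⟨⟨⟨w, Function.update a w b⟩, fun w' hw' => ?_⟩, rfl, ?_, fun w' hw' => ?_⟩
      · simpa only [Function.update_of_ne hw'] using hx w' hw'
      · simpa only [Function.update_self] using hb
      · exact Function.update_of_ne hw' _ _
    opp_move := by
      rintro ⟨⟨w, a⟩, hx⟩ hown y hy
      by_cases hpos : (g w).pos (a w) = v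
      · have hall : ∀ w', (g w').pos (a w') = v := by
          intro w'
          by_cases hw' : w' = w
          · rw [hw']; exact hpos
          · exact hx w' hw'
        have hy' : E v y := by simpa only [hpos] using hy
        obtain ⟨b, hb, hby⟩ := (g ⟨y, hy'⟩).opp_move (a ⟨y, hy'⟩) (by rw [hall]; exact hv) y
          ⟨by rw [hall]; exact hy', fun _ => rfl⟩
        refine ⟨⟨⟨⟨y, hy'⟩, Function.update a ⟨y, hy'⟩ b⟩, fun w' hw' => ?_⟩,
          ⟨?_, ?_, fun w' hw' => ?_⟩, ?_⟩
        · simpa only [Function.update_of_ne hw'] using hall w'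
        · exact (hall _).trans hpos.symm
        · simpa only [Function.update_self] using hb
        · exact Function.update_of_ne hw' _ _
        · simpa only [Function.update_self] using hby
      · obtain ⟨b, hb, hby⟩ := (g w).opp_move (a w) hown y ⟨hy, fun h => absurd h hpos⟩
        refine ⟨⟨⟨w, Function.update a w b⟩, fun w' hw' => ?_⟩, ⟨rfl, ?_, fun w' hw' => ?_⟩, ?_⟩
        · simpa only [Function.update_of_ne hw'] using hx w' hw'
        · simpa only [Function.update_self] using hb
        · exact Function.update_of_ne hw' _ _
        · simpa only [Function.update_self] using hby
    win := by
      intro q hq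
      refine MaxRecurringEven.of_shuffle (fun t => (q (t + 1)).1.1) fun w hw => ?_
      set N := Nat.nth fun t => (q (t + 1)).1.1 = w with hN
      have hlab : ∀ n, (q (N n + 1)).1.1 = w := fun n => Nat.nth_mem_of_infinite hw n
      have hstay : ∀ n t, N n + 1 ≤ t → t ≤ N (n + 1) →
          (q t).1.2 w = (q (N n + 1)).1.2 w := by
        intro n t ht
        induction t, ht using Nat.le_induction with
        | base => intro _; rfl
        | succ t ht ih =>
          intro ht'
          rw [← ih (by omega)]
          refine (hq t).2.2 w fun hlt => ?_
          have : t ≤ N n := Nat.le_nth_of_lt_nth_succ (Nat.lt_of_succ_le ht') hlt.symm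
          omega
      have hstep : ∀ n, (g w).Step ((q (N n)).1.2 w) ((q (N (n + 1))).1.2 w) := by
        intro n
        rw [hstay n _ (Nat.nth_strictMono hw (Nat.lt_succ_self n)) le_rfl]
        have := (hq (N n)).2.1
        rwa [hlab n] at this
      convert (g w).win _ hstep using 3 with n
      have := (hq (N n)).1
      rw [hlab n] at this
      exact this.symm }

/-- If the player wins against each restriction of the opponent to one move at `v`, she wins. -/
theorem nonempty_of_forall_restrict [Finite P] (hv : ¬ own v) (hE : ∃ w, E v w)
    (h : ∀ w, E v w → Nonempty (StrategyGraph own (fun x y => E x y ∧ (x = v → y = w)) pr s)) :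
    Nonempty (StrategyGraph own E pr s) := by
  have g : ∀ w : {w // E v w}, StrategyGraph own (fun x y => E x y ∧ (x = v → y = w)) pr s :=
    fun w => (h w w.2).some
  by_cases hav : ∃ w, ∀ a, Relation.ReflTransGen (g w).Step (g w).root a → (g w).pos a ≠ v
  · obtain ⟨w, hw⟩ := hav
    exact ⟨ofAvoiding (g w) hw⟩
  · push Not at hav
    choose wait _ hwait using hav
    obtain ⟨w₀, hw₀⟩ := hE
    exact ⟨shuffle hv g ⟨w₀, hw₀⟩ wait hwait⟩

theorem nonempty_of_forall_positional_on [Finite P] (B : Finset P) (hB : ∀ x ∈ B, ¬ own x) :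
    ∀ E : P → P → Prop, (∀ x, ∃ y, E x y) →
      (∀ τ : P → P, (∀ x, E x (τ x)) →
        Nonempty (StrategyGraph own (fun x y => E x y ∧ (x ∈ B → y = τ x)) pr s)) →
      Nonempty (StrategyGraph own E pr s) := by
  classical
  induction B using Finset.induction_on with
  | empty =>
    intro E hE h
    choose τ hτ using hE
    simpa using h τ hτ
  | insert v B hvB ih =>
    intro E hE h
    refine nonempty_of_forall_restrict (hB v (Finset.mem_insert_self v B)) (hE v) fun w hw => ?_
    refine ih (fun x hx => hB x (Finset.mem_insert_of_mem hx)) _ (fun x => ?_) fun τ hτ => ?_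
    · by_cases hx : x = v
      · exact ⟨w, hx ▸ hw, fun _ => rfl⟩
      · obtain ⟨y, hy⟩ := hE x
        exact ⟨y, hy, fun h => absurd h hx⟩
    · have hτv := (hτ v).2 rfl
      have key : (fun x y => E x y ∧ (x ∈ insert v B → y = τ x)) =
          fun x y => (E x y ∧ (x = v → y = w)) ∧ (x ∈ B → y = τ x) := by
        ext x y
        rw [Finset.mem_insert, and_assoc, or_imp]
        refine and_congr_right fun _ => and_congr_left fun _ => ?_
        constructor <;> · rintro h rfl; rw [h rfl, hτv]
      exact key ▸ h τ fun x => (hτ x).1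

/-- If the player wins against every positional strategy `τ` of the opponent, then she wins. -/
theorem nonempty_of_forall_positional [Finite P] (hE : ∀ x, ∃ y, E x y)
    (h : ∀ τ : P → P, (∀ x, E x (τ x)) →
      Nonempty (StrategyGraph own (fun x y => E x y ∧ (¬ own x → y = τ x)) pr s)) :
    Nonempty (StrategyGraph own E pr s) := by
  classical
  have := Fintype.ofFinite P
  refine nonempty_of_forall_positional_on (Finset.univ.filter fun x => ¬ own x) (by simp) E hE ?_
  simpa using h

end StrategyGraph

/-! ### Loops as strategies -/

/-- A sequence that runs through the dates before `y` in order, always returning from `y - 1` to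
`x`, meets the maximum of `c` on the loop infinitely often. -/
theorem MaxRecurringEven.of_loop {c f : ℕ → ℕ} {x y : ℕ} (hxy : x < y) (hc : c x = c y)
    (hm : Even ((Finset.Icc x y).sup c)) (hlt : ∀ t, f t < y)
    (hf : ∀ t, f (t + 1) = if f t + 1 = y then x else f t + 1) :
    MaxRecurringEven fun t => c (f t) := by
  have hreturn : ∀ d t, f t + d + 1 = y → ∃ t' ≥ t, f t' = x := by
    intro d
    induction d with
    | zero =>
      intro t ht
      exact ⟨t + 1, Nat.le_succ t, by rw [hf, if_pos (by omega)]⟩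
    | succ d ih =>
      intro t ht
      obtain ⟨t', ht', h⟩ := ih (t + 1) (by rw [hf, if_neg (by omega)]; omega)
      exact ⟨t', by omega, h⟩
  have hreturn' : ∀ t, ∃ t' ≥ t, f t' = x := fun t =>
    hreturn (y - (f t + 1)) t (by have := hlt t; omega)
  have hrun : ∀ t, f t = x → ∀ i, x + i < y → f (t + i) = x + i := by
    intro t ht i
    induction i with
    | zero => intro _; exact ht
    | succ i ih =>
      intro hi
      rw [← add_assoc, hf, ih (by omega), if_neg (by omega)]
      rfl
  obtain ⟨z, hz, hzm⟩ : ∃ z, (x ≤ z ∧ z < y) ∧ (Finset.Icc x y).sup c = c z := by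
    obtain ⟨z, hz, hzm⟩ := Finset.exists_mem_eq_sup _ (Finset.nonempty_Icc.2 hxy.le) c
    rw [Finset.mem_Icc] at hz
    rcases hz.2.eq_or_lt with rfl | h
    · exact ⟨x, ⟨le_rfl, hxy⟩, hzm.trans hc.symm⟩
    · exact ⟨z, ⟨hz.1, h⟩, hzm⟩
  refine ⟨_, hm, Filter.frequently_atTop.2 fun t => ?_, ?_⟩
  · obtain ⟨t', ht', h⟩ := hreturn' t
    refine ⟨t' + (z - x), by omega, ?_⟩
    change c (f _) = _
    rw [hzm, hrun t' h (z - x) (by omega), Nat.add_sub_cancel' hz.1]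
  · obtain ⟨t₀, -, h⟩ := hreturn' 0
    refine Filter.eventually_atTop.2 ⟨t₀, fun t ht => ?_⟩
    have hx : x ≤ f t := by
      induction t, ht using Nat.le_induction with
      | base => exact h.ge
      | succ t _ ih => rw [hf]; split_ifs <;> omega
    exact Finset.le_sup (Finset.mem_Icc.2 ⟨hx, (hlt t).le⟩)

/-- In an arena where the opponent never has a choice, a path of positions that closes a cycle with
even maximal priority gives a winning strategy: the player repeats the cycle forever. -/
def StrategyGraph.ofLoop {P : Type u} {own : P → Prop} {E : P → P → Prop} {pr : P → ℕ}
    (q : ℕ → P) (hq : ∀ t, E (q t) (q (t + 1)))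
    (hdet : ∀ a, ¬ own a → ∀ b b', E a b → E a b' → b = b') {x y : ℕ} (hxy : x < y)
    (hqxy : q x = q y) (hm : Even ((Finset.Icc x y).sup fun t => pr (q t))) :
    StrategyGraph own E pr (q 0) :=
  have next : ∀ a : Fin y, ∃ b : Fin y, (b : ℕ) = (if (a : ℕ) + 1 = y then x else a + 1) ∧
      q b = q (a + 1) := by
    intro a
    have ha := a.2
    split_ifs with h
    · exact ⟨⟨x, hxy⟩, rfl, by rw [h, ← hqxy]⟩
    · exact ⟨⟨a + 1, by omega⟩, rfl, rfl⟩
  { State := ULift (Fin y)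
    root := ⟨⟨0, by omega⟩⟩
    pos := fun a => q a.down
    Step := fun a b => (b.down : ℕ) = if (a.down : ℕ) + 1 = y then x else a.down + 1
    pos_root := rfl
    edge := by
      intro a b hab
      obtain ⟨b', hb', hqb⟩ := next a.down
      rw [← Fin.ext (hab.trans hb'.symm)] at hqb
      rw [hqb]
      exact hq _
    own_move := by
      intro a _
      obtain ⟨b, hb, -⟩ := next a.down
      exact ⟨⟨b⟩, hb⟩
    opp_move := by
      intro a ha z hz
      obtain ⟨b, hb, hqb⟩ := next a.down
      exact ⟨⟨b⟩, hb, hqb.trans (hdet _ ha _ _ (hq _) hz)⟩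
    win := fun f hf => MaxRecurringEven.of_loop (c := fun t => pr (q t))
      (f := fun t => ((f t).down : ℕ)) hxy (by simp only [hqxy]) hm (fun t => (f t).down.2) hf }

/-! ### From the statistics game to the parity game -/

namespace ParityGame

variable {V : Type u} (G : ParityGame V)

/-- The edges of the arena whose positions consist of a vertex and of a Boolean telling whether it
is Anke's turn. -/
def TurnEdge (x y : V × Bool) : Prop := G.Edge x.1 y.1 ∧ y.2 = !x.2

theorem decide_even_succ (t : ℕ) : decide (Even (t + 1)) = !decide (Even t) := by
  rw [← decide_not, decide_eq_decide, Nat.even_add_one]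

theorem ankeWinsParityGame_of_strategyGraph
    (g : StrategyGraph (fun x : V × Bool => x.2 = true) G.TurnEdge (fun x => G.priority x.1)
      (G.start, true)) : G.AnkeWinsParityGame := by
  classical
  let step : g.State → V → g.State := fun a v =>
    if h : ∃ b, g.Step a b ∧ (g.pos b).1 = v then h.choose else a
  have step_spec : ∀ a v, (∃ b, g.Step a b ∧ (g.pos b).1 = v) →
      g.Step a (step a v) ∧ (g.pos (step a v)).1 = v := by
    intro a v h
    simp only [step, dif_pos h]
    exact h.choose_spec
  -- The root lies over the start vertex, so that the state depends on the later vertices only.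
  let state : List V → g.State := fun l => l.tail.foldl step g.root
  have next : ∀ h v, ∃ w, G.Edge v w ∧ ((∃ b, g.Step (state (h ++ [v])) b ∧
      G.Edge v (g.pos b).1) → ∃ b, g.Step (state (h ++ [v])) b ∧ (g.pos b).1 = w) := by
    intro h v
    by_cases hb : ∃ b, g.Step (state (h ++ [v])) b ∧ G.Edge v (g.pos b).1
    · obtain ⟨b, hb, hv⟩ := hb
      exact ⟨_, hv, fun _ => ⟨b, hb, rfl⟩⟩
    · obtain ⟨w, hw⟩ := G.exists_edge v
      exact ⟨w, hw, fun h => absurd h hb⟩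
  choose nxt hvalid hnext using next
  refine ⟨⟨nxt, hvalid⟩, fun p hp hσ => ?_⟩
  let q : ℕ → g.State := fun t => state ((List.range t).map p ++ [p t])
  have hq0 : q 0 = g.root := rfl
  have hqs : ∀ t, q (t + 1) = step (q t) (p (t + 1)) := by
    intro t
    simp only [q, state]
    rw [List.range_succ, List.map_append, List.map_singleton,
      List.tail_append_of_ne_nil (by simp), List.foldl_append]
    rfl
  have hmove : ∀ t, g.pos (q t) = (p t, decide (Even t)) →
      ∃ b, g.Step (q t) b ∧ (g.pos b).1 = p (t + 1) := by
    intro t ht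
    by_cases he : Even t
    · obtain ⟨b, hb⟩ := g.own_move (q t) (by simp [ht, he])
      rw [hσ t he]
      refine hnext _ _ ⟨b, hb, ?_⟩
      have := (g.edge hb).1
      rwa [ht] at this
    · obtain ⟨b, hb, hby⟩ := g.opp_move (q t) (by simp [ht, he]) (p (t + 1), true)
        ⟨by rw [ht]; exact hp.2 t, by simp [ht, he]⟩
      exact ⟨b, hb, by rw [hby]⟩
  have hpos : ∀ t, g.pos (q t) = (p t, decide (Even t)) := by
    intro t
    induction t with
    | zero => rw [hq0, g.pos_root, hp.1]; rfl
    | succ t ih =>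
      obtain ⟨h1, h2⟩ := step_spec _ _ (hmove t ih)
      rw [hqs]
      refine Prod.ext h2 ?_
      rw [(g.edge h1).2, ih, decide_even_succ]
  have hwin := g.win q fun t => by
    rw [hqs]
    exact (step_spec _ _ (hmove t (hpos t))).1
  simp only [hpos] at hwin
  exact hwin.even_limsup

/-- The play in which Anke follows `σ` and Boris follows the positional strategy `τ`. -/
theorem exists_play {σ : G.Strategy} {τ : V → V} (hτ : ∀ v, G.Edge v (τ v)) :
    ∃ p, G.IsPlay p ∧ σ.AnkeFollows p ∧ ∀ t, ¬ Even t → p (t + 1) = τ (p t) := by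
  let hist : ℕ → List V × V := fun t => Nat.rec ([], G.start)
    (fun t x => (x.1 ++ [x.2], if Even t then σ.next x.1 x.2 else τ x.2)) t
  have hs : ∀ t, hist (t + 1) = ((hist t).1 ++ [(hist t).2],
      if Even t then σ.next (hist t).1 (hist t).2 else τ (hist t).2) := fun _ => rfl
  have hl : ∀ t, (hist t).1 = (List.range t).map fun t => (hist t).2 := by
    intro t
    induction t with
    | zero => rfl
    | succ t ih => rw [hs, List.range_succ, List.map_append, List.map_singleton, ← ih]
  refine ⟨fun t => (hist t).2, ⟨rfl, fun t => ?_⟩, fun t ht => ?_, fun t ht => ?_⟩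
  · simp only [hs]
    split_ifs
    · exact σ.valid _ _
    · exact hτ _
  · simp only [hs, if_pos ht, ← hl]
  · simp only [hs, if_neg ht]

/-- A strategy that wins the statistics game beats each positional strategy `τ` of Boris in the
parity game: the play of the two contains an even cycle, which Anke can repeat. -/
theorem nonempty_strategyGraph_of_positional [Fintype V] {k : ℕ}
    (hk : 2 * Fintype.card V < 2 ^ k) (h : G.AnkeWinsStatisticsGame k) {τ : V × Bool → V × Bool}
    (hτ : ∀ x, G.TurnEdge x (τ x)) :
    Nonempty (StrategyGraph (fun x : V × Bool => x.2 = true)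
      (fun x y => G.TurnEdge x y ∧ (¬ x.2 = true → y = τ x)) (fun x => G.priority x.1)
      (G.start, true)) := by
  obtain ⟨σ, hσ⟩ := h
  obtain ⟨p, hp, hpσ, hpτ⟩ := G.exists_play (σ := σ) (τ := fun v => (τ (v, false)).1)
    fun v => (hτ (v, false)).1
  obtain ⟨t, ht⟩ := hσ p hp hpσ
  obtain ⟨x, y, hxy, hpxy, hpar, hm⟩ := G.exists_even_cycle hk ht
  have hstart : (G.start, true) = (p 0, decide (Even 0)) := by simp [hp.1]
  rw [hstart]
  refine ⟨StrategyGraph.ofLoop (fun t => (p t, decide (Even t))) (fun t => ?_) ?_ hxy ?_ hm⟩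
  · refine ⟨⟨hp.2 t, decide_even_succ t⟩, fun he => ?_⟩
    have he : ¬ Even t := by simpa using he
    have h2 := (hτ (p t, false)).2
    simp only [decide_even_succ, he, decide_false, hpτ t he]
    exact Prod.ext rfl h2.symm
  · rintro a ha b b' ⟨-, hb⟩ ⟨-, hb'⟩
    rw [hb ha, hb' ha]
  · simp only [Prod.mk.injEq, decide_eq_decide]
    exact ⟨hpxy, hpar⟩

end ParityGame

theorem mainTheorem2 {V : Type*} [Fintype V] (G : ParityGame V) (k : ℕ)
    (hk : 2 * Fintype.card V < 2 ^ k) (h : G.AnkeWinsStatisticsGame k) :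
    G.AnkeWinsParityGame := by
  have hE : ∀ x, ∃ y, G.TurnEdge x y := fun x =>
    let ⟨w, hw⟩ := G.exists_edge x.1
    ⟨(w, !x.2), hw, rfl⟩
  obtain ⟨g⟩ := StrategyGraph.nonempty_of_forall_positional hE
    fun τ hτ => G.nonempty_strategyGraph_of_positional hk h hτ
  exact G.ankeWinsParityGame_of_strategyGraph g
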